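/- Let $S$ be a connected $s$-dimensional smooth embedded submanifold of $\mathbb{R}^{m+1}$, and let $\mathcal{D} \supset TS$ be a smooth distribution of rank $m$ along $S$, that is, a smooth rank-$m$ subbundle of the ambient tangent bundle over $S$ with $T_pS \subset \mathcal{D}_p$ for all $p \in S$. Let $\mathcal{D}^{\perp}$ be the line bundle over $S$ whose fiber at $p$ is the orthogonal complement of $\mathcal{D}_p$ in $\mathbb{R}^{m+1}$. Suppose that there exists a smooth section $N^{*}$ of $\mathcal{D}^{\perp}$ such that the shape operator of $S$ in direction $N^{*}$, that is, the map $A^{*}_p \colon T_pS \to T_pS$ sending $v$ to the orthogonal projection of $\nabla_v N^{*}$ onto $T_pS$ (where $\nabla$ is the Euclidean connection), has rank $s$ for every $p \in S$. Then there exists a rank-$s$ hypersurface $M$ of $\mathbb{R}^{m+1}$ such that $S \subset M$ and $T_pM = \mathcal{D}_p$ for all $p \in S$. Here a rank-$s$ hypersurface is an $m$-dimensional smooth embedded submanifold $M$ of $\mathbb{R}^{m+1}$ such that at every point $p \in M$ the relative nullity space $\{x \in T_pM \mid \alpha_p(x,\cdot) = 0\}$ of its second fundamental form $\alpha$ has dimension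 $m-s$. -/

import Mathlib

open scoped ContDiff Topology

noncomputable section

namespace ConstantRank

variable {E : Type*} [NormedAddCommGroup E] [InnerProductSpace ℝ E]

/-- `S` is a `k`-dimensional smooth (`C^∞`) embedded submanifold of `E`: around each of its points
there is a slice chart, that is, a diffeomorphism between open subsets of `E` that carries the part
of `S` in its source onto the part in its target of a `k`-dimensional linear subspace `W`. -/
def IsEmbeddedSubmanifold (k : ℕ) (S : Set E) : Prop :=
  ∀ p ∈ S, ∃ (Φ : OpenPartialHomeomorph E E) (W : Submodule ℝ E),
    p ∈ Φ.source ∧ Module.finrank ℝ W = k ∧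
    ContDiffOn ℝ ∞ Φ Φ.source ∧ ContDiffOn ℝ ∞ Φ.symm Φ.target ∧
    ∀ x ∈ Φ.source, x ∈ S ↔ Φ x ∈ W

/-- The set of velocities at `p` of the smooth curves in `S` through `p`. -/
def velocities (S : Set E) (p : E) : Set E :=
  {v | ∃ γ : ℝ → E, γ 0 = p ∧ (∀ᶠ t in 𝓝 0, γ t ∈ S) ∧ ContDiffAt ℝ ∞ γ 0 ∧ HasDerivAt γ v 0}

/-- The tangent space `T_p S`, as a linear subspace of `E`. (When `S` is an embedded submanifold,
the velocities already form a subspace, so that taking the span changes nothing.) -/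
def tangentSpace (S : Set E) (p : E) : Submodule ℝ E :=
  Submodule.span ℝ (velocities S p)

/-- The Euclidean derivative `∇_v f` at `p ∈ S`, in a direction `v ∈ T_p S`, of a map `f` along `S`.
Only the values of `f` on `S` matter. -/
def nabla (S : Set E) (f : E → E) (p : E) : E →L[ℝ] E :=
  fderivWithin ℝ f S p

/-- `nabla` is well defined: on `T_p S` it agrees with every derivative of `f` within `S` at `p`. -/
theorem nabla_eq {S : Set E} {f : E → E} {p v : E} {L : E →L[ℝ] E}
    (hf : HasFDerivWithinAt f L S p) (hv : v ∈ tangentSpace S p) : nabla S f p v = L v := by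
  have hn : HasFDerivWithinAt f (nabla S f p) S p := hf.differentiableWithinAt.hasFDerivWithinAt
  induction hv using Submodule.span_induction with
  | mem w hw =>
    obtain ⟨γ, h0, hS, -, hd⟩ := hw
    exact (hn.comp_hasDerivAt_of_eq 0 hd hS h0.symm).unique
      (hf.comp_hasDerivAt_of_eq 0 hd hS h0.symm)
  | zero => simp
  | add x y _ _ hx hy => rw [map_add, map_add, hx, hy]
  | smul c x _ hx => rw [map_smul, map_smul, hx]

/-- `D` (of which only the fibres `D p` with `p ∈ S` matter) is a smooth distribution of rank `m`
along `S`: near each point of `S` it is spanned by a smooth frame of `m` vector fields along `S`. -/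
def IsSmoothDistribution (m : ℕ) (S : Set E) (D : E → Submodule ℝ E) : Prop :=
  ∀ p ∈ S, ∃ (U : Set E) (X : Fin m → E → E), IsOpen U ∧ p ∈ U ∧
    (∀ i, ContDiffOn ℝ ∞ (X i) (S ∩ U)) ∧
    ∀ q ∈ S ∩ U, LinearIndependent ℝ (fun i => X i q) ∧
      Submodule.span ℝ (Set.range fun i => X i q) = D q

/-- `N` is a smooth section over `S` of the distribution `D^⊥` of orthogonal complements. -/
def IsNormalSection (S : Set E) (D : E → Submodule ℝ E) (N : E → E) : Prop :=
  ContDiffOn ℝ ∞ N S ∧ ∀ p ∈ S, N p ∈ (D p)ᗮ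

variable [FiniteDimensional ℝ E]

/-- The shape operator of `S` at `p` in the direction of a normal field `N`:
the endomorphism `v ↦ π (∇_v N)` of `T_p S`, with `π` the orthogonal projection onto `T_p S`. -/
def shapeOperator (S : Set E) (N : E → E) (p : E) : tangentSpace S p →ₗ[ℝ] tangentSpace S p :=
  (tangentSpace S p).orthogonalProjectionOnto.toLinearMap ∘ₗ
    (nabla S N p).toLinearMap ∘ₗ (tangentSpace S p).subtype

/-- The second fundamental form `α(x, y)` of `M` at `p`, for `x, y ∈ T_p M`: the component normal to
`M` of `∇_x Y`, where `Y` extends `y` to a tangent field of `M`. The extension used here is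
`Y q = π_{T_q M} y`; the value does not depend on this choice. -/
def secondFundamentalForm (M : Set E) (p x y : E) : E :=
  (tangentSpace M p)ᗮ.starProjection
    (nabla M (fun q => (tangentSpace M q).starProjection y) p x)

/-- The relative nullity space `Δ = {x ∈ T_p M | α(x, ·) = 0}` of `M` at `p`. -/
def relativeNullity (M : Set E) (p : E) : Submodule ℝ E where
  carrier := {x | x ∈ tangentSpace M p ∧
    ∀ y ∈ tangentSpace M p, secondFundamentalForm M p x y = 0}
  zero_mem' := ⟨Submodule.zero_mem _, fun y _ => by simp [secondFundamentalForm]⟩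
  add_mem' := fun {a b} ha hb => ⟨Submodule.add_mem _ ha.1 hb.1, fun y hy => by
    have h1 := ha.2 y hy
    have h2 := hb.2 y hy
    simp only [secondFundamentalForm] at h1 h2 ⊢
    rw [map_add, map_add, h1, h2, add_zero]⟩
  smul_mem' := fun c a ha => ⟨Submodule.smul_mem _ c ha.1, fun y hy => by
    have h1 := ha.2 y hy
    simp only [secondFundamentalForm] at h1 ⊢
    rw [map_smul, map_smul, h1, smul_zero]⟩

/-- `M` is an `m`-dimensional rank-`s` submanifold of `E`: a smooth embedded submanifold whose
index of relative nullity `dim Δ` is `m - s` at every point. -/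
def IsRankSubmanifold (m s : ℕ) (M : Set E) : Prop :=
  IsEmbeddedSubmanifold m M ∧ ∀ p ∈ M, Module.finrank ℝ (relativeNullity M p) + s = m

end ConstantRank

end

/-! `M` is the envelope of the affine hyperplanes `q + N(q)^⊥` with `q ∈ S`. Near `S`, let `π y ∈ S`
be the foot point of `y`: the solution `q` of `⟪y - q, ∇_v N⟫ = 0` for all `v ∈ T_q S`. On the
diagonal `y = q` the linearization of this equation in `q` is minus the bilinear form of the shape
operator, so nondegeneracy and the implicit function theorem yield a locally unique smooth `π`, with
`π = id` on `S` (`LocalParam.exists_adapted`); uniqueness glues the local maps (`exists_glue`).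

Put `h y = ⟪y - π y, N (π y)⟫`. In its derivative the term `⟪dπ v, N⟫` vanishes because `N` is
normal to `S`, and `⟪y - π y, d(N ∘ π) v⟫` vanishes by the foot point equation. Hence `grad h = N ∘
π`, and `M = {h = 0}` near `S` is a hypersurface through `S` with tangent space `N(p)^⊥ = D_p` along
`S`.

Up to a nonzero factor, the second fundamental form of `M` is that of `d(N ∘ π)` compressed to the
tangent hyperplane (`finrank_relativeNullity_levelSet`). This has rank at most `s`, since `N ∘ π`
factors through `S`; along `S` it is injective on `T_p S`, so the rank is at least `s` there, and by
semicontinuity nearby. All this needs `N ≠ 0`, which `exists_nonvanishing_normalSection` arranges.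
-/

noncomputable section

namespace ConstantRank

open Set Filter

variable {E : Type*} [NormedAddCommGroup E] [InnerProductSpace ℝ E]

/-! ### Local parametrizations and tangent spaces -/

/-- A smooth local parametrization of `S ⊆ E` by an open subset of the normed space `F`, together
with a smooth map `inv`, defined on an open subset of the ambient space, that inverts it. -/
structure LocalParam (S : Set E) (F : Type*) [NormedAddCommGroup F] [NormedSpace ℝ F] where
  toFun : F → E
  inv : E → F
  dom : Set F
  nhd : Set E
  isOpen_dom : IsOpen dom
  isOpen_nhd : IsOpen nhd
  contDiffOn_toFun : ContDiffOn ℝ ∞ toFun dom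
  contDiffOn_inv : ContDiffOn ℝ ∞ inv nhd
  toFun_mem : ∀ w ∈ dom, toFun w ∈ S
  toFun_mem_nhd : ∀ w ∈ dom, toFun w ∈ nhd
  inv_toFun : ∀ w ∈ dom, inv (toFun w) = w
  inv_mem : ∀ q ∈ S, q ∈ nhd → inv q ∈ dom
  toFun_inv : ∀ q ∈ S, q ∈ nhd → toFun (inv q) = q

theorem IsEmbeddedSubmanifold.exists_localParam [FiniteDimensional ℝ E] {k : ℕ} {S : Set E}
    (hS : IsEmbeddedSubmanifold k S) {p : E} (hp : p ∈ S) :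
    ∃ (W : Submodule ℝ E) (φ : LocalParam S W), Module.finrank ℝ W = k ∧ p ∈ φ.nhd := by
  obtain ⟨Φ, W, hpΦ, hW, hΦ, hΦ', hSW⟩ := hS p hp
  have hval : ContDiff ℝ ∞ (fun w : W => (w : E)) := W.subtypeL.contDiff
  refine ⟨W, {
    toFun := fun w => Φ.symm w
    inv := fun q => W.orthogonalProjectionOnto (Φ q)
    dom := {w | (w : E) ∈ Φ.target}
    nhd := Φ.source
    isOpen_dom := Φ.open_target.preimage continuous_subtype_val
    isOpen_nhd := Φ.open_source
    contDiffOn_toFun := hΦ'.comp hval.contDiffOn (fun w hw => hw)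
    contDiffOn_inv := W.orthogonalProjectionOnto.contDiff.comp_contDiffOn hΦ
    toFun_mem := fun w hw => ?_
    toFun_mem_nhd := fun w hw => Φ.map_target hw
    inv_toFun := fun w hw => ?_
    inv_mem := fun q hq hqn => ?_
    toFun_inv := fun q hq hqn => ?_ }, hW, hpΦ⟩
  · rw [hSW _ (Φ.map_target hw), Φ.right_inv hw]
    exact w.2
  · simp only [Φ.right_inv (show (w : E) ∈ Φ.target from hw)]
    exact Submodule.orthogonalProjectionOnto_mem_subspace_eq_self w
  · have h := (hSW q hqn).1 hq
    have h2 : (W.orthogonalProjectionOnto (Φ q)) = ⟨Φ q, h⟩ :=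
      Submodule.orthogonalProjectionOnto_mem_subspace_eq_self ⟨Φ q, h⟩
    simp only [h2, mem_ofPred_eq]
    exact Φ.map_source hqn
  · have h := (hSW q hqn).1 hq
    have h2 : (W.orthogonalProjectionOnto (Φ q)) = ⟨Φ q, h⟩ :=
      Submodule.orthogonalProjectionOnto_mem_subspace_eq_self ⟨Φ q, h⟩
    simp only [h2]
    exact Φ.left_inv hqn

namespace LocalParam

variable {F : Type*} [NormedAddCommGroup F] [NormedSpace ℝ F] {S : Set E} (φ : LocalParam S F)

theorem contDiffAt_toFun {w : F} (hw : w ∈ φ.dom) : ContDiffAt ℝ ∞ φ.toFun w :=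
  φ.contDiffOn_toFun.contDiffAt (φ.isOpen_dom.mem_nhds hw)

theorem hasFDerivAt_toFun {w : F} (hw : w ∈ φ.dom) :
    HasFDerivAt φ.toFun (fderiv ℝ φ.toFun w) w :=
  ((φ.contDiffAt_toFun hw).differentiableAt (by simp)).hasFDerivAt

theorem hasFDerivAt_inv {q : E} (hq : q ∈ φ.nhd) :
    HasFDerivAt φ.inv (fderiv ℝ φ.inv q) q :=
  ((φ.contDiffOn_inv.contDiffAt (φ.isOpen_nhd.mem_nhds hq)).differentiableAt
    (by simp)).hasFDerivAt

theorem fderiv_inv_comp {w : F} (hw : w ∈ φ.dom) (u : F) :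
    fderiv ℝ φ.inv (φ.toFun w) (fderiv ℝ φ.toFun w u) = u := by
  have h1 := (φ.hasFDerivAt_inv (φ.toFun_mem_nhd w hw)).comp w (φ.hasFDerivAt_toFun hw)
  have h2 : HasFDerivAt (φ.inv ∘ φ.toFun) (ContinuousLinearMap.id ℝ F) w :=
    (hasFDerivAt_id w).congr_of_eventuallyEq (by
      filter_upwards [φ.isOpen_dom.mem_nhds hw] with x hx using φ.inv_toFun x hx)
  simpa using congrArg (fun L : F →L[ℝ] F => L u) (h1.unique h2)

theorem fderiv_toFun_injective {w : F} (hw : w ∈ φ.dom) :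
    Function.Injective (fderiv ℝ φ.toFun w) :=
  Function.LeftInverse.injective (g := fderiv ℝ φ.inv (φ.toFun w)) (φ.fderiv_inv_comp hw)

theorem fderiv_mem_tangentSpace {w : F} (hw : w ∈ φ.dom) (u : F) :
    fderiv ℝ φ.toFun w u ∈ tangentSpace S (φ.toFun w) := by
  apply Submodule.subset_span
  have hl : ContDiff ℝ ∞ (fun t : ℝ => w + t • u) := by fun_prop
  have hd : HasDerivAt (fun t : ℝ => w + t • u) u 0 := by
    simpa using ((hasDerivAt_id (0 : ℝ)).smul_const u).const_add w
  have hw0 : w + (0 : ℝ) • u = w := by simp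
  refine ⟨fun t => φ.toFun (w + t • u), by simp, ?_, ?_, ?_⟩
  · have : ∀ᶠ t in 𝓝 (0 : ℝ), w + t • u ∈ φ.dom :=
      hl.continuous.continuousAt.eventually_mem (by
        rw [hw0]; exact φ.isOpen_dom.mem_nhds hw)
    filter_upwards [this] with t ht using φ.toFun_mem _ ht
  · refine ContDiffAt.comp (0 : ℝ) (g := φ.toFun) ?_ hl.contDiffAt
    rw [hw0]; exact φ.contDiffAt_toFun hw
  · exact (φ.hasFDerivAt_toFun hw).comp_hasDerivAt_of_eq 0 hd hw0.symm

/-- A curve `γ` in `S` equals `toFun ∘ inv ∘ γ` near time `0`, so its velocity is the image of that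
of `inv ∘ γ`. -/
theorem tangentSpace_eq {w : F} (hw : w ∈ φ.dom) :
    tangentSpace S (φ.toFun w) = LinearMap.range (fderiv ℝ φ.toFun w).toLinearMap := by
  apply le_antisymm
  · refine Submodule.span_le.2 ?_
    rintro v ⟨γ, h0, hS, -, hd⟩
    have hn := φ.toFun_mem_nhd w hw
    have h1 := (φ.hasFDerivAt_inv hn).comp_hasDerivAt_of_eq 0 hd h0.symm
    have h2 := (φ.hasFDerivAt_toFun hw).comp_hasDerivAt_of_eq 0 h1 (by simp [h0, φ.inv_toFun w hw])
    have h3 : φ.toFun ∘ φ.inv ∘ γ =ᶠ[𝓝 0] γ := by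
      have : ∀ᶠ t in 𝓝 (0 : ℝ), γ t ∈ φ.nhd :=
        hd.continuousAt.eventually_mem (by rw [h0]; exact φ.isOpen_nhd.mem_nhds hn)
      filter_upwards [hS, this] with t ht ht' using φ.toFun_inv _ ht ht'
    have h4 := h2.unique (hd.congr_of_eventuallyEq h3)
    exact ⟨_, h4⟩
  · rintro _ ⟨u, rfl⟩
    exact φ.fderiv_mem_tangentSpace hw u

theorem finrank_tangentSpace {w : F} (hw : w ∈ φ.dom) :
    Module.finrank ℝ (tangentSpace S (φ.toFun w)) = Module.finrank ℝ F := by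
  rw [φ.tangentSpace_eq hw]
  exact LinearMap.finrank_range_of_inj (φ.fderiv_toFun_injective hw)

end LocalParam

theorem IsEmbeddedSubmanifold.finrank_tangentSpace [FiniteDimensional ℝ E] {k : ℕ} {S : Set E}
    (hS : IsEmbeddedSubmanifold k S) {p : E} (hp : p ∈ S) :
    Module.finrank ℝ (tangentSpace S p) = k := by
  obtain ⟨W, φ, hW, hpn⟩ := hS.exists_localParam hp
  have := φ.finrank_tangentSpace (φ.inv_mem p hp hpn)
  rwa [φ.toFun_inv p hp hpn, hW] at this

/-! ### Projection onto a hyperplane -/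

/-- The orthogonal projection onto the hyperplane orthogonal to `a`, for `a ≠ 0`. -/
def perpProj (a : E) : E →L[ℝ] E :=
  ContinuousLinearMap.id ℝ E - (‖a‖ ^ 2)⁻¹ • (innerSL ℝ a).smulRight a

theorem perpProj_apply (a x : E) : perpProj a x = x - ((‖a‖ ^ 2)⁻¹ * inner ℝ a x) • a := by
  simp [perpProj, smul_smul]

theorem perpProj_apply_of_inner_eq_zero {a x : E} (h : inner ℝ a x = 0) : perpProj a x = x := by
  simp [perpProj_apply, h]

theorem inner_perpProj {a : E} (x : E) : inner ℝ a (perpProj a x) = 0 := by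
  rcases eq_or_ne a 0 with rfl | ha
  · simp
  have : ‖a‖ ^ 2 ≠ 0 := by positivity
  rw [perpProj_apply, inner_sub_right, inner_smul_right, real_inner_self_eq_norm_sq]
  field_simp
  ring

theorem inner_perpProj_left {a x y : E} (h : inner ℝ a y = 0) :
    inner ℝ (perpProj a x) y = inner ℝ x y := by
  rw [perpProj_apply, inner_sub_left, inner_smul_left, h]
  simp

theorem starProjection_orthogonal_singleton (a x : E) :
    (ℝ ∙ a)ᗮ.starProjection x = perpProj a x := by
  rw [Submodule.starProjection_orthogonal, perpProj_apply]
  simp only [sub_apply, ContinuousLinearMap.id_apply]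
  rw [Submodule.starProjection_singleton ℝ x]
  simp [div_eq_inv_mul]

/-- Needed for the compressed derivative of the normal field to vary continuously, so that its rank
cannot drop near a point of `S`. -/
theorem continuousAt_perpProj {a : E} (ha : a ≠ 0) : ContinuousAt perpProj a := by
  have h1 : ContinuousAt (fun a : E => (‖a‖ ^ 2)⁻¹) a :=
    ContinuousAt.inv₀ (by fun_prop) (by positivity)
  have h2 : Continuous (fun a : E => (innerSL ℝ a).smulRight a) := by
    have := (ContinuousLinearMap.smulRightL ℝ E E).isBoundedBilinearMap.continuous
    exact this.comp ((innerSL ℝ).continuous.prodMk continuous_id)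
  exact continuousAt_const.sub (h1.smul h2.continuousAt)

/-! ### Regular level sets and their relative nullity -/

/-- Inverse function theorem, with smoothness of the inverse on the whole target. -/
theorem exists_smooth_openPartialHomeomorph [CompleteSpace E] {f : E → E} {U : Set E}
    (hU : IsOpen U) (hf : ContDiffOn ℝ ∞ f U) {a : E} (ha : a ∈ U)
    (hfa : HasFDerivAt f (ContinuousLinearMap.id ℝ E) a) :
    ∃ Φ : OpenPartialHomeomorph E E, a ∈ Φ.source ∧ Φ.source ⊆ U ∧ (Φ : E → E) = f ∧
      ContDiffOn ℝ ∞ Φ Φ.source ∧ ContDiffOn ℝ ∞ Φ.symm Φ.target := by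
  have hat : ∀ x ∈ U, ContDiffAt ℝ ∞ f x := fun x hx => hf.contDiffAt (hU.mem_nhds hx)
  have hfd : ContinuousOn (fderiv ℝ f) U := hf.continuousOn_fderiv_of_isOpen hU (by simp)
  -- Shrinking to the open set where the derivative is invertible makes the inverse smooth at every
  -- point of the target, not just at `f a`.
  set V : Set E := U ∩ fderiv ℝ f ⁻¹' range (ContinuousLinearEquiv.toContinuousLinearMap)
  have hV : IsOpen V := hfd.isOpen_inter_preimage hU ContinuousLinearEquiv.isOpen
  have haV : a ∈ V := ⟨ha, ContinuousLinearEquiv.refl ℝ E, hfa.fderiv.symm⟩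
  have hfa' : HasFDerivAt f ((ContinuousLinearEquiv.refl ℝ E : E ≃L[ℝ] E) : E →L[ℝ] E) a := hfa
  set Ψ := (hat a ha).toOpenPartialHomeomorph f hfa' (by simp)
  have hΨ : (Ψ : E → E) = f := rfl
  have haΨ : a ∈ Ψ.source := (hat a ha).mem_toOpenPartialHomeomorph_source hfa' (by simp)
  have hsub : (Ψ.restrOpen V hV).source ⊆ V := by
    rw [Ψ.restrOpen_source]; exact inter_subset_right
  refine ⟨Ψ.restrOpen V hV, ?_, fun x hx => (hsub hx).1, hΨ, ?_, ?_⟩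
  · rw [Ψ.restrOpen_source]; exact ⟨haΨ, haV⟩
  · exact hf.mono fun x hx => (hsub hx).1
  · intro y hy
    have hx := hsub ((Ψ.restrOpen V hV).map_target hy)
    obtain ⟨e, he⟩ := hx.2
    refine ((Ψ.restrOpen V hV).contDiffAt_symm (f₀' := e) hy ?_ (hat _ hx.1)).contDiffWithinAt
    rw [he]
    exact ((hat _ hx.1).differentiableAt (by simp)).hasFDerivAt

/-- A regular level set is an embedded hypersurface. -/
theorem isEmbeddedSubmanifold_levelSet [CompleteSpace E] {m : ℕ}
    [Fact (Module.finrank ℝ E = m + 1)] {U : Set E} (hU : IsOpen U) {h : E → ℝ} {n : E → E}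
    (hh : ContDiffOn ℝ ∞ h U) (hn : ∀ y ∈ U, HasFDerivAt h (innerSL ℝ (n y)) y)
    (hn0 : ∀ y ∈ U, n y ≠ 0) : IsEmbeddedSubmanifold m {y | y ∈ U ∧ h y = 0} := by
  rintro a ⟨ha, -⟩
  set c := n a
  have hc : ‖c‖ ^ 2 ≠ 0 := by have := hn0 a ha; positivity
  -- Only the `c`-component of `y` is changed, so that it records `h`: `⟪c, f y⟫ = h y`. As `c` is
  -- the gradient of `h` at `a`, the derivative of `f` there is the identity.
  set f : E → E := fun y => y + ((‖c‖ ^ 2)⁻¹ * (h y - inner ℝ c y)) • c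
  have hf : ContDiffOn ℝ ∞ f U := by
    refine contDiffOn_id.add ((contDiffOn_const.mul (hh.sub ?_)).smul contDiffOn_const)
    exact (innerSL ℝ c).contDiff.contDiffOn
  have hfa : HasFDerivAt f (ContinuousLinearMap.id ℝ E) a := by
    have h1 := (((hn a ha).sub (innerSL ℝ c).hasFDerivAt).const_mul ((‖c‖ ^ 2)⁻¹)).smul_const c
    have h2 := (hasFDerivAt_id a).add h1
    refine h2.congr_fderiv ?_
    ext v
    simp [c]
  obtain ⟨Φ, haΦ, hΦU, rfl', h1, h2⟩ := exists_smooth_openPartialHomeomorph hU hf ha hfa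
  refine ⟨Φ, (ℝ ∙ c)ᗮ, haΦ, Submodule.finrank_orthogonal_span_singleton (hn0 a ha), h1, h2, ?_⟩
  intro x hx
  have : inner ℝ c (f x) = h x := by
    simp only [f]
    rw [inner_add_right, inner_smul_right, real_inner_self_eq_norm_sq, mul_right_comm,
      inv_mul_cancel₀ hc]
    ring
  rw [rfl', Submodule.mem_orthogonal_singleton_iff_inner_right, this]
  exact ⟨fun h => h.2, fun h => ⟨hΦU hx, h⟩⟩

theorem tangentSpace_levelSet [FiniteDimensional ℝ E] {m : ℕ}
    [Fact (Module.finrank ℝ E = m + 1)] {U : Set E} (hU : IsOpen U) {h : E → ℝ} {n : E → E}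
    (hh : ContDiffOn ℝ ∞ h U) (hn : ∀ y ∈ U, HasFDerivAt h (innerSL ℝ (n y)) y)
    (hn0 : ∀ y ∈ U, n y ≠ 0) {a : E} (ha : a ∈ U) (hha : h a = 0) :
    tangentSpace {y | y ∈ U ∧ h y = 0} a = (ℝ ∙ n a)ᗮ := by
  apply Submodule.eq_of_le_of_finrank_eq
  · refine Submodule.span_le.2 ?_
    rintro v ⟨γ, h0, hS, -, hd⟩
    have h1 := (hn a ha).comp_hasDerivAt_of_eq 0 hd h0.symm
    have h2 : h ∘ γ =ᶠ[𝓝 0] fun _ => 0 := by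
      filter_upwards [hS] with t ht using ht.2
    have h3 := h1.unique ((hasDerivAt_const (0 : ℝ) (0 : ℝ)).congr_of_eventuallyEq h2)
    simpa [Submodule.mem_orthogonal_singleton_iff_inner_right] using h3
  · rw [(isEmbeddedSubmanifold_levelSet (m := m) hU hh hn hn0).finrank_tangentSpace ⟨ha, hha⟩,
      Submodule.finrank_orthogonal_span_singleton (n := m) (hn0 a ha)]

/-- The tangent field extending `y` is `y - ‖n‖⁻² ⟪n, y⟫ n`. Since `⟪n a, y⟫ = 0`, only the
derivative of the factor `⟪n, y⟫` survives, and the result is already normal. -/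
theorem secondFundamentalForm_levelSet [FiniteDimensional ℝ E] {m : ℕ}
    [Fact (Module.finrank ℝ E = m + 1)] {U : Set E} (hU : IsOpen U) {h : E → ℝ} {n : E → E}
    (hh : ContDiffOn ℝ ∞ h U) (hn : ∀ y ∈ U, HasFDerivAt h (innerSL ℝ (n y)) y)
    (hn0 : ∀ y ∈ U, n y ≠ 0) {a : E} (ha : a ∈ U) (hha : h a = 0)
    (hna : DifferentiableAt ℝ n a) {x y : E} (hx : inner ℝ (n a) x = 0)
    (hy : inner ℝ (n a) y = 0) :
    secondFundamentalForm {y | y ∈ U ∧ h y = 0} a x y =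
      -((‖n a‖ ^ 2)⁻¹ * inner ℝ (fderiv ℝ n a x) y) • n a := by
  set M := {y | y ∈ U ∧ h y = 0}
  have hT : ∀ q ∈ M, tangentSpace M q = (ℝ ∙ n q)ᗮ :=
    fun q hq => tangentSpace_levelSet (m := m) hU hh hn hn0 hq.1 hq.2
  have haM : a ∈ M := ⟨ha, hha⟩
  have hna0 : ‖n a‖ ^ 2 ≠ 0 := by have := hn0 a ha; positivity
  have hr : DifferentiableAt ℝ (fun q => (‖n q‖ ^ 2)⁻¹) a := (hna.norm_sq ℝ).inv hna0
  have hi : HasFDerivAt (fun q => inner ℝ (n q) y) _ a :=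
    hna.hasFDerivAt.inner ℝ (hasFDerivAt_const y a)
  have hc := (hr.hasFDerivAt.mul hi).smul hna.hasFDerivAt
  have hL := (hasFDerivAt_const y a).sub hc
  have hL' := hL.hasFDerivWithinAt (s := M)
  have hcongr : HasFDerivWithinAt (fun q => (tangentSpace M q).starProjection y) _ M a :=
    hL'.congr (fun q hq => by
      simp only [hT q hq]
      rw [starProjection_orthogonal_singleton, perpProj_apply]; rfl) (by
      simp only [hT a haM]
      rw [starProjection_orthogonal_singleton, perpProj_apply]; rfl)
  have hxT : x ∈ tangentSpace M a := by
    rw [hT a haM, Submodule.mem_orthogonal_singleton_iff_inner_right]; exact hx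
  rw [secondFundamentalForm, nabla_eq hcongr hxT]
  simp only [hT a haM, Submodule.orthogonal_orthogonal]
  rw [Submodule.starProjection_eq_self_iff.2]
  · simp [hy, fderivInnerCLM_apply]
  · rw [Submodule.mem_span_singleton]
    refine ⟨-((‖n a‖ ^ 2)⁻¹ * inner ℝ (fderiv ℝ n a x) y), ?_⟩
    simp [hy, fderivInnerCLM_apply]

/-- The relative nullity is the kernel of the compressed derivative of `n` on the tangent
hyperplane, and restricting to the hyperplane does not change the range; rank-nullity in dimension
`m` concludes. -/
theorem finrank_relativeNullity_levelSet [FiniteDimensional ℝ E] {m : ℕ}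
    [Fact (Module.finrank ℝ E = m + 1)] {U : Set E} (hU : IsOpen U) {h : E → ℝ} {n : E → E}
    (hh : ContDiffOn ℝ ∞ h U) (hn : ∀ y ∈ U, HasFDerivAt h (innerSL ℝ (n y)) y)
    (hn0 : ∀ y ∈ U, n y ≠ 0) {a : E} (ha : a ∈ U) (hha : h a = 0)
    (hna : DifferentiableAt ℝ n a) :
    Module.finrank ℝ (relativeNullity {y | y ∈ U ∧ h y = 0} a) +
      Module.finrank ℝ (LinearMap.range
        (perpProj (n a) ∘L fderiv ℝ n a ∘L perpProj (n a)).toLinearMap) = m := by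
  set M := {y | y ∈ U ∧ h y = 0}
  set B := perpProj (n a) ∘L fderiv ℝ n a ∘L perpProj (n a)
  set T : Submodule ℝ E := (ℝ ∙ n a)ᗮ
  have hT : tangentSpace M a = T := tangentSpace_levelSet (m := m) hU hh hn hn0 ha hha
  have hmem : ∀ x, x ∈ T ↔ inner ℝ (n a) x = 0 :=
    fun x => Submodule.mem_orthogonal_singleton_iff_inner_right
  have hna0 : ‖n a‖ ^ 2 ≠ 0 := by have := hn0 a ha; positivity
  have hnull : relativeNullity M a =
      (LinearMap.ker (B.toLinearMap ∘ₗ T.subtype)).map T.subtype := by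
    ext x
    have h1 : x ∈ relativeNullity M a ↔
        x ∈ T ∧ ∀ y ∈ T, secondFundamentalForm M a x y = 0 := by rw [← hT]; rfl
    rw [h1]
    simp only [Submodule.mem_map, LinearMap.mem_ker, LinearMap.comp_apply, Submodule.subtype_apply]
    constructor
    · rintro ⟨hx, hxy⟩
      refine ⟨⟨x, hx⟩, ?_, rfl⟩
      -- Testing against `y = B x` yields `⟪B x, B x⟫ = 0`.
      have hBT : B x ∈ T := (hmem _).2 (inner_perpProj _)
      have h2 := hxy _ hBT
      rw [secondFundamentalForm_levelSet (m := m) hU hh hn hn0 ha hha hna ((hmem x).1 hx)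
        ((hmem _).1 hBT), smul_eq_zero, or_iff_left (hn0 a ha), neg_eq_zero, mul_eq_zero,
        or_iff_right (inv_ne_zero hna0), ← inner_perpProj_left ((hmem _).1 hBT)] at h2
      have h3 : perpProj (n a) (fderiv ℝ n a x) = B x := by
        simp [B, perpProj_apply_of_inner_eq_zero ((hmem x).1 hx)]
      rw [h3] at h2
      exact inner_self_eq_zero.1 h2
    · rintro ⟨⟨z, hz⟩, hB, rfl⟩
      refine ⟨hz, fun y hy => ?_⟩
      have h3 : perpProj (n a) (fderiv ℝ n a z) = 0 := by
        rw [← hB]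
        simp [B, perpProj_apply_of_inner_eq_zero ((hmem z).1 hz)]
      rw [secondFundamentalForm_levelSet (m := m) hU hh hn hn0 ha hha hna ((hmem z).1 hz)
        ((hmem _).1 hy), ← inner_perpProj_left ((hmem _).1 hy), h3]
      simp
  have hrange : LinearMap.range B.toLinearMap =
      LinearMap.range (B.toLinearMap ∘ₗ T.subtype) := by
    apply le_antisymm
    · rintro _ ⟨x, rfl⟩
      refine ⟨⟨perpProj (n a) x, (hmem _).2 (inner_perpProj x)⟩, ?_⟩
      simp [B, perpProj_apply_of_inner_eq_zero (inner_perpProj x)]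
    · exact LinearMap.range_comp_le_range _ _
  rw [hnull, Submodule.finrank_map_subtype_eq, hrange, add_comm,
    LinearMap.finrank_range_add_finrank_ker]
  exact Submodule.finrank_orthogonal_span_singleton (hn0 a ha)

/-! ### Smooth implicit functions and gluing of local solutions -/

/-- Implicit function theorem, with smoothness of the implicit function near the base point. -/
theorem exists_smooth_implicitFunction {E₁ E₂ F : Type*}
    [NormedAddCommGroup E₁] [NormedSpace ℝ E₁] [CompleteSpace E₁]
    [NormedAddCommGroup E₂] [NormedSpace ℝ E₂] [CompleteSpace E₂]
    [NormedAddCommGroup F] [NormedSpace ℝ F] [CompleteSpace F]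
    {f : E₁ × E₂ → F} {u : E₁ × E₂} (hf : ∀ᶠ v in 𝓝 u, ContDiffAt ℝ ∞ f v)
    (hu : (fderiv ℝ f u ∘L .inr ℝ E₁ E₂).IsInvertible) :
    ∃ ψ : E₁ → E₂, ψ u.1 = u.2 ∧ (∀ᶠ x in 𝓝 u.1, ContDiffAt ℝ ∞ ψ x) ∧
      (∀ᶠ x in 𝓝 u.1, f (x, ψ x) = f u) ∧ ∀ᶠ v in 𝓝 u, f v = f u → ψ v.1 = v.2 := by
  have hfu := hf.self_of_nhds
  have h0 : (∞ : WithTop ℕ∞) ≠ 0 := by simp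
  set ψ := hfu.implicitFunction h0 hu
  have hψu : ψ u.1 = u.2 := hfu.implicitFunction_apply_self h0 hu
  have hiff := hfu.eventually_apply_eq_iff_implicitFunction h0 hu
  have heq := hfu.eventually_apply_implicitFunction h0 hu
  refine ⟨ψ, hψu, ?_, heq, hiff.mono fun v hv => hv.1⟩
  have hinv : ∀ᶠ v in 𝓝 u, (fderiv ℝ f v ∘L .inr ℝ E₁ E₂).IsInvertible := by
    obtain ⟨e, he⟩ := hu
    have hc : ContinuousAt (fun v => fderiv ℝ f v ∘L .inr ℝ E₁ E₂) u :=
      (hfu.continuousAt_fderiv (by simp)).clm_comp continuousAt_const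
    have := e.nhds
    rw [he] at this
    exact hc.eventually_mem this
  have hψc : ContinuousAt ψ u.1 := (hfu.contDiffAt_implicitFunction h0 hu).continuousAt
  have hgr : Tendsto (fun x => (x, ψ x)) (𝓝 u.1) (𝓝 u) := by
    have := (continuousAt_id (x := u.1)).prodMk hψc
    simpa [ContinuousAt, hψu] using this
  have hall := hgr.eventually ((hf.and hinv).and hiff.eventually_nhds)
  have hψc' : ∀ᶠ x in 𝓝 u.1, ContinuousAt ψ x := by
    have := (hfu.contDiffAt_implicitFunction h0 hu).of_le (m := 1) (by simp)
    filter_upwards [this.eventually (by simp)] with x hx using hx.continuousAt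
  -- The theorem applied afresh at `(x, ψ x)` gives a function smooth at `x`; local uniqueness at
  -- `u` identifies it with `ψ` near `x`.
  filter_upwards [hall, heq.eventually_nhds] with x ⟨⟨hx1, hx2⟩, hx3⟩ hx4
  have hsm := hx1.contDiffAt_implicitFunction h0 hx2
  have hval := hx1.implicitFunction_apply_self h0 hx2
  have heqx := hx1.eventually_apply_implicitFunction h0 hx2
  have hgr' : Tendsto (fun y => (y, hx1.implicitFunction h0 hx2 y)) (𝓝 x) (𝓝 (x, ψ x)) := by
    have := (continuousAt_id (x := x)).prodMk hsm.continuousAt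
    simpa [ContinuousAt, hval] using this
  refine hsm.congr_of_eventuallyEq ?_
  filter_upwards [heqx, hgr'.eventually hx3] with y hy hy'
  exact hy'.1 (by rw [hy, hx4.self_of_nhds])

/-- Local solutions `g p` near `p ∈ S` of `y ↦ (q ∈ S with R y q)` that are locally unique fit
together. -/
theorem exists_glue {X : Type*} [PseudoMetricSpace X] {S : Set X} {R : X → X → Prop}
    {g : X → X → X} (hself : ∀ p ∈ S, g p p = p) (hcont : ∀ p ∈ S, ContinuousAt (g p) p)
    (hsol : ∀ p ∈ S, ∀ᶠ y in 𝓝 p, g p y ∈ S ∧ R y (g p y))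
    (huniq : ∀ p ∈ S, ∀ᶠ z in 𝓝 (p, p), z.2 ∈ S → R z.1 z.2 → z.2 = g p z.1) :
    ∃ π : X → X, ∀ p ∈ S, π =ᶠ[𝓝 p] g p := by
  -- The factor 3 is for the triangle inequality below: if `r p' ≤ r p`, then `g p' y` lies within
  -- `r p' + η p' + η p ≤ 3 * r p` of `p`, so uniqueness at `p` applies to it.
  have h1 : ∀ p ∈ S, ∃ r > 0, ∀ y q, dist y p < 3 * r → dist q p < 3 * r → q ∈ S → R y q →
      q = g p y := by
    intro p hp
    obtain ⟨r, hr, h⟩ := Metric.eventually_nhds_iff.1 (huniq p hp)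
    refine ⟨r / 3, by positivity, fun y q hy hq => h (y := (y, q)) ?_⟩
    rw [Prod.dist_eq]
    simp only [max_lt_iff]
    constructor <;> linarith
  choose! r hr hruniq using h1
  have h2 : ∀ p ∈ S, ∃ η > 0, η ≤ r p ∧ ∀ y, dist y p < η →
      dist (g p y) p < r p ∧ g p y ∈ S ∧ R y (g p y) := by
    intro p hp
    have hc : ∀ᶠ y in 𝓝 p, dist (g p y) p < r p := by
      have := (hcont p hp).eventually_mem (Metric.ball_mem_nhds (g p p) (hr p hp))
      rwa [hself p hp] at this
    obtain ⟨η, hη, h⟩ := Metric.eventually_nhds_iff.1 (hc.and (hsol p hp))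
    exact ⟨min η (r p), lt_min hη (hr p hp), min_le_right _ _,
      fun y hy => h (hy.trans_le (min_le_left _ _))⟩
  choose! η hη hηr hηsol using h2
  have key : ∀ p ∈ S, ∀ p' ∈ S, ∀ y, dist y p < η p → dist y p' < η p' → r p' ≤ r p →
      g p' y = g p y := by
    intro p hp p' hp' y hy hy' hle
    obtain ⟨ha, hb, hc⟩ := hηsol p' hp' y hy'
    have e1 := hηr p hp
    have e2 := hηr p' hp'
    have e3 := hr p hp
    refine hruniq p hp y _ (by linarith) ?_ hb hc
    have t1 := dist_triangle (g p' y) p' p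
    have t2 := dist_triangle_left p' p y
    linarith
  classical
  -- Any admissible centre will do, since two admissible centres give the same value.
  let c : X → X := fun y => if h : ∃ p ∈ S, dist y p < η p then h.choose else y
  refine ⟨fun y => g (c y) y, fun p hp => ?_⟩
  filter_upwards [Metric.ball_mem_nhds p (hη p hp)] with y hy
  have hex : ∃ p ∈ S, dist y p < η p := ⟨p, hp, hy⟩
  have hcy : c y = hex.choose := dif_pos hex
  obtain ⟨hcS, hcd⟩ := hex.choose_spec
  rw [← hcy] at hcS hcd
  rcases le_total (r (c y)) (r p) with h | h
  · exact key p hp _ hcS y hy hcd h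
  · exact (key _ hcS p hp y hcd hy h).symm

/-! ### Foot points and adapted maps -/

/-- `y - q` is orthogonal to all derivatives of `N` at `q` along `S`, that is, `q` is a critical
point of the function `q ↦ ⟪y - q, N q⟫` on `S` when `N` is normal to `S`. -/
def IsFootPoint (S : Set E) (N : E → E) (y q : E) : Prop :=
  ∀ v ∈ tangentSpace S q, inner ℝ (y - q) (nabla S N q v) = 0

theorem isFootPoint_self (S : Set E) (N : E → E) (q : E) : IsFootPoint S N q q :=
  fun v _ => by simp

namespace LocalParam

variable {F : Type*} [NormedAddCommGroup F] [NormedSpace ℝ F] {S : Set E} (φ : LocalParam S F)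
  {N : E → E}

theorem contDiffOn_comp (hN : ContDiffOn ℝ ∞ N S) : ContDiffOn ℝ ∞ (N ∘ φ.toFun) φ.dom :=
  hN.comp φ.contDiffOn_toFun φ.toFun_mem

theorem hasFDerivAt_comp (hN : ContDiffOn ℝ ∞ N S) {w : F} (hw : w ∈ φ.dom) :
    HasFDerivAt (N ∘ φ.toFun) (fderiv ℝ (N ∘ φ.toFun) w) w :=
  (((φ.contDiffOn_comp hN).contDiffAt (φ.isOpen_dom.mem_nhds hw)).differentiableAt
    (by simp)).hasFDerivAt

theorem nabla_apply (hN : ContDiffOn ℝ ∞ N S) {w : F} (hw : w ∈ φ.dom) (u : F) :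
    nabla S N (φ.toFun w) (fderiv ℝ φ.toFun w u) = fderiv ℝ (N ∘ φ.toFun) w u := by
  have h1 : HasFDerivWithinAt N (nabla S N (φ.toFun w)) S (φ.toFun w) :=
    ((hN _ (φ.toFun_mem w hw)).differentiableWithinAt (by simp)).hasFDerivWithinAt
  have h2 := h1.comp_hasFDerivAt w (φ.hasFDerivAt_toFun hw) (by
    filter_upwards [φ.isOpen_dom.mem_nhds hw] with x hx using φ.toFun_mem x hx)
  rw [h2.fderiv]
  rfl

/-- Turns the condition into one smooth equation with values in the dual of `F`, which has the
dimension of the unknown `w`. -/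
theorem isFootPoint_iff (hN : ContDiffOn ℝ ∞ N S) {w : F} (hw : w ∈ φ.dom) (y : E) :
    IsFootPoint S N y (φ.toFun w) ↔
      innerSL ℝ (y - φ.toFun w) ∘L fderiv ℝ (N ∘ φ.toFun) w = 0 := by
  rw [IsFootPoint, φ.tangentSpace_eq hw]
  constructor
  · intro h
    ext u
    simpa [φ.nabla_apply hN hw, inner_sub_left] using h _ ⟨u, rfl⟩
  · rintro h _ ⟨u, rfl⟩
    have := congrArg (fun L : F →L[ℝ] ℝ => L u) h
    simpa [φ.nabla_apply hN hw, inner_sub_left] using this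

end LocalParam

/-- The conditions under which the level sets of `y ↦ ⟪y - π y, N (π y)⟫` near `y` are rank-`s`
hypersurfaces with normal field `N ∘ π`. -/
structure IsAdapted (s : ℕ) (N π : E → E) (y : E) : Prop where
  contDiffAt : ContDiffAt ℝ ∞ π y
  contDiffAt_normal : ContDiffAt ℝ ∞ (N ∘ π) y
  hasFDerivAt : HasFDerivAt (fun y => inner ℝ (y - π y) (N (π y))) (innerSL ℝ (N (π y))) y
  ne_zero : N (π y) ≠ 0
  finrank_eq : Module.finrank ℝ (LinearMap.range
    (perpProj (N (π y)) ∘L fderiv ℝ (N ∘ π) y ∘L perpProj (N (π y))).toLinearMap) = s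

theorem IsAdapted.congr {s : ℕ} {N π π' : E → E} {y : E} (h : IsAdapted s N π y)
    (hπ : π' =ᶠ[𝓝 y] π) : IsAdapted s N π' y := by
  have hn : N ∘ π' =ᶠ[𝓝 y] N ∘ π := hπ.fun_comp N
  have hy : π' y = π y := hπ.self_of_nhds
  refine ⟨h.contDiffAt.congr_of_eventuallyEq hπ, h.contDiffAt_normal.congr_of_eventuallyEq hn,
    ?_, hy ▸ h.ne_zero, ?_⟩
  · rw [hy]
    refine h.hasFDerivAt.congr_of_eventuallyEq ?_
    filter_upwards [hπ] with x hx
    rw [hx]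
  · rw [hy, hn.fderiv_eq]
    exact h.finrank_eq

/-- Local existence, uniqueness and smoothness of the foot point map near `p ∈ S`. -/
theorem LocalParam.exists_adapted [FiniteDimensional ℝ E] {s : ℕ} {S : Set E} {F : Type*}
    [NormedAddCommGroup F] [InnerProductSpace ℝ F] [FiniteDimensional ℝ F]
    (hF : Module.finrank ℝ F = s) (φ : LocalParam S F) {N : E → E} (hN : ContDiffOn ℝ ∞ N S)
    (hnormal : ∀ q ∈ S, ∀ v ∈ tangentSpace S q, inner ℝ v (N q) = 0)
    {p : E} (hp : p ∈ S) (hpn : p ∈ φ.nhd) (hNp : N p ≠ 0)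
    (hleft : ∀ v ∈ tangentSpace S p,
      (∀ u ∈ tangentSpace S p, inner ℝ v (nabla S N p u) = 0) → v = 0)
    (hright : ∀ u ∈ tangentSpace S p,
      (∀ v ∈ tangentSpace S p, inner ℝ v (nabla S N p u) = 0) → u = 0) :
    ∃ π : E → E, π p = p ∧ ContinuousAt π p ∧
      (∀ᶠ y in 𝓝 p, π y ∈ S ∧ IsFootPoint S N y (π y)) ∧
      (∀ᶠ z in 𝓝 (p, p), z.2 ∈ S → IsFootPoint S N z.1 z.2 → z.2 = π z.1) ∧
      ∀ᶠ y in 𝓝 p, IsAdapted s N π y := by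
  obtain ⟨w₀, hw₀, rfl⟩ : ∃ w₀ ∈ φ.dom, φ.toFun w₀ = p :=
    ⟨φ.inv p, φ.inv_mem p hp hpn, φ.toFun_inv p hp hpn⟩
  set p := φ.toFun w₀
  set ν : F → E := N ∘ φ.toFun
  have hν : ContDiffOn ℝ ∞ ν φ.dom := φ.contDiffOn_comp hN
  have hdν : ContDiffOn ℝ ∞ (fderiv ℝ ν) φ.dom := hν.fderiv_of_isOpen φ.isOpen_dom (by simp)
  set G : E × F → (F →L[ℝ] ℝ) := fun z => innerSL ℝ (z.1 - φ.toFun z.2) ∘L fderiv ℝ ν z.2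
  have hdomev : ∀ᶠ z : E × F in 𝓝 (p, w₀), z.2 ∈ φ.dom :=
    continuous_snd.continuousAt.eventually_mem (φ.isOpen_dom.mem_nhds hw₀)
  have hG : ∀ z : E × F, z.2 ∈ φ.dom → ContDiffAt ℝ ∞ G z := by
    intro z hz
    have h1 : ContDiffAt ℝ ∞ (fun z : E × F => φ.toFun z.2) z :=
      (φ.contDiffAt_toFun hz).comp z contDiffAt_snd
    have h2 : ContDiffAt ℝ ∞ (fun z : E × F => fderiv ℝ ν z.2) z :=
      ContDiffAt.comp z (hdν.contDiffAt (φ.isOpen_dom.mem_nhds hz)) contDiffAt_snd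
    exact ((innerSL ℝ).contDiff.contDiffAt.comp z (contDiffAt_fst.sub h1)).clm_comp h2
  have hG0 : G (p, w₀) = 0 := by simp [G, p]
  -- At the base point `y - q = 0`, so the term with the second derivative of `ν` drops out and
  -- minus the bilinear form of the shape operator remains.
  have hpartial : ∀ u u', (fderiv ℝ G (p, w₀) ∘L .inr ℝ E F) u u' =
      - inner ℝ (fderiv ℝ φ.toFun w₀ u) (fderiv ℝ ν w₀ u') := by
    intro u u'
    have h1 : HasFDerivAt (fun w => G (p, w)) (fderiv ℝ G (p, w₀) ∘L .inr ℝ E F) w₀ :=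
      ((hG (p, w₀) hw₀).differentiableAt (by simp)).hasFDerivAt.comp w₀
        (hasFDerivAt_prodMk_right p w₀)
    have h2 : HasFDerivAt (fun w => innerSL ℝ (p - φ.toFun w))
        (innerSL ℝ ∘L (0 - fderiv ℝ φ.toFun w₀)) w₀ :=
      (innerSL ℝ).hasFDerivAt.comp w₀ ((hasFDerivAt_const p w₀).sub (φ.hasFDerivAt_toFun hw₀))
    have h3 := h2.clm_comp ((hdν.contDiffAt (φ.isOpen_dom.mem_nhds hw₀)).differentiableAt
      (by simp)).hasFDerivAt
    rw [h1.unique h3]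
    simp [p]
    rfl
  have hinv : (fderiv ℝ G (p, w₀) ∘L .inr ℝ E F).IsInvertible := by
    set L := fderiv ℝ G (p, w₀) ∘L .inr ℝ E F
    have hinj : Function.Injective L := by
      refine (injective_iff_map_eq_zero L).2 fun u hu => ?_
      have h1 : fderiv ℝ φ.toFun w₀ u = 0 := by
        refine hleft _ (φ.fderiv_mem_tangentSpace hw₀ u) ?_
        rw [φ.tangentSpace_eq hw₀]
        rintro _ ⟨u', rfl⟩
        have h2 := hpartial u u'
        rw [hu] at h2
        have h3 := φ.nabla_apply hN hw₀ u'
        change inner ℝ _ (nabla S N (φ.toFun w₀) (fderiv ℝ φ.toFun w₀ u')) = 0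
        rw [h3]
        simpa using h2
      exact φ.fderiv_toFun_injective hw₀ (by rw [h1, map_zero])
    have hdim : Module.finrank ℝ F = Module.finrank ℝ (F →L[ℝ] ℝ) :=
      (InnerProductSpace.toDual ℝ F).toLinearEquiv.finrank_eq
    exact ⟨(LinearEquiv.ofInjectiveOfFinrankEq L.toLinearMap hinj hdim).toContinuousLinearEquiv,
      by ext; rfl⟩
  obtain ⟨σ, hσp, hσs, hσG, hσu⟩ := exists_smooth_implicitFunction
    (hdomev.mono fun z hz => hG z hz) hinv
  simp only [hG0] at hσp hσs hσG hσu
  have hσc : ContinuousAt σ p := hσs.self_of_nhds.continuousAt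
  have hσdom : ∀ᶠ y in 𝓝 p, σ y ∈ φ.dom :=
    hσc.eventually_mem (by rw [hσp]; exact φ.isOpen_dom.mem_nhds hw₀)
  have hπp : φ.toFun (σ p) = p := by rw [hσp]
  have hπs : ∀ᶠ y in 𝓝 p, ContDiffAt ℝ ∞ (φ.toFun ∘ σ) y := by
    filter_upwards [hσs, hσdom] with y h1 h2 using (φ.contDiffAt_toFun h2).comp y h1
  have hns : ∀ᶠ y in 𝓝 p, ContDiffAt ℝ ∞ (ν ∘ σ) y := by
    filter_upwards [hσs, hσdom] with y h1 h2
    exact (hν.contDiffAt (φ.isOpen_dom.mem_nhds h2)).comp y h1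
  have huniq : ∀ᶠ z in 𝓝 (p, p), z.2 ∈ S → IsFootPoint S N z.1 z.2 → z.2 = φ.toFun (σ z.1) := by
    have hpn : p ∈ φ.nhd := φ.toFun_mem_nhd w₀ hw₀
    have h1 : ∀ᶠ z : E × E in 𝓝 (p, p), z.2 ∈ φ.nhd :=
      continuous_snd.continuousAt.eventually_mem (φ.isOpen_nhd.mem_nhds hpn)
    have h2 : Tendsto (fun z : E × E => (z.1, φ.inv z.2)) (𝓝 (p, p)) (𝓝 (p, w₀)) := by
      have h3 : ContinuousAt φ.inv p := (φ.hasFDerivAt_inv hpn).continuousAt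
      have h4 : ContinuousAt (fun z : E × E => (z.1, φ.inv z.2)) (p, p) :=
        continuousAt_fst.prodMk (ContinuousAt.comp (x := (p, p)) h3 continuousAt_snd)
      simpa [ContinuousAt, φ.inv_toFun w₀ hw₀, p] using h4
    filter_upwards [h1, h2.eventually hσu] with z hz1 hz2 hzS hzR
    have hzd := φ.inv_mem _ hzS hz1
    have hze := φ.toFun_inv _ hzS hz1
    rw [← hze, φ.isFootPoint_iff hN hzd] at hzR
    rw [hz2 hzR, hze]
  refine ⟨φ.toFun ∘ σ, hπp, hπs.self_of_nhds.continuousAt, ?_, huniq, ?_⟩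
  · filter_upwards [hσG, hσdom] with y h1 h2
    exact ⟨φ.toFun_mem _ h2, (φ.isFootPoint_iff hN h2 y).2 h1⟩
  have hNπ : ContinuousAt (fun y => N (φ.toFun (σ y))) p := hns.self_of_nhds.continuousAt
  have hne : ∀ᶠ y in 𝓝 p, N (φ.toFun (σ y)) ≠ 0 :=
    hNπ.eventually_ne (by rwa [hπp])
  set B : E → E →L[ℝ] E := fun y => perpProj (N (φ.toFun (σ y))) ∘L fderiv ℝ (ν ∘ σ) y ∘L
    perpProj (N (φ.toFun (σ y)))
  have hBc : ContinuousAt B p := by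
    have h1 : ContinuousAt (fun y => perpProj (N (φ.toFun (σ y)))) p :=
      ContinuousAt.comp (f := fun y => N (φ.toFun (σ y))) (g := perpProj)
        (continuousAt_perpProj (by rwa [hπp])) hNπ
    exact h1.clm_comp ((hns.self_of_nhds.continuousAt_fderiv (by simp)).clm_comp h1)
  -- Each point of `S` is its own foot point, so by uniqueness `N ∘ π = N` on `S` near `p`.
  have hderiv : ∀ u ∈ tangentSpace S p, nabla S N p u = fderiv ℝ (ν ∘ σ) p u := by
    intro u hu
    have h1 : HasFDerivWithinAt (ν ∘ σ) (fderiv ℝ (ν ∘ σ) p) S p :=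
      (hns.self_of_nhds.differentiableAt (by simp)).hasFDerivAt.hasFDerivWithinAt
    refine nabla_eq (h1.congr_of_eventuallyEq ?_ ?_) hu
    · have hdiag : Tendsto (fun q : E => (q, q)) (𝓝 p) (𝓝 (p, p)) :=
        (continuous_id.prodMk continuous_id).continuousAt
      filter_upwards [nhdsWithin_le_nhds (hdiag.eventually huniq), self_mem_nhdsWithin] with q hq hqS
      exact congrArg N (hq hqS (isFootPoint_self S N q))
    · exact (congrArg N hπp).symm
  -- At `p` the compression is injective on the `s`-dimensional space `T_p S`. The bound then
  -- spreads to a neighbourhood, because having rank at least `s` is an open condition.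
  have hrank : ((s : ℕ) : Cardinal) ≤ (B p).toLinearMap.rank := by
    have hinj : Function.Injective ((B p).toLinearMap ∘ₗ (tangentSpace S p).subtype) := by
      rw [injective_iff_map_eq_zero]
      rintro ⟨u, hu⟩ hBu
      simp only [LinearMap.comp_apply, Submodule.subtype_apply, ContinuousLinearMap.coe_coe] at hBu
      have hperp : ∀ v ∈ tangentSpace S p, inner ℝ (N (φ.toFun (σ p))) v = 0 := fun v hv => by
        rw [hπp, real_inner_comm]; exact hnormal p hp v hv
      have hz : u = 0 := by
        refine hright u hu fun v hv => ?_
        rw [hderiv u hu, real_inner_comm, ← inner_perpProj_left (hperp v hv)]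
        have : B p u = perpProj (N (φ.toFun (σ p))) (fderiv ℝ (ν ∘ σ) p u) := by
          simp [B, perpProj_apply_of_inner_eq_zero (hperp u hu)]
        rw [← this, hBu, inner_zero_left]
      simp [hz]
    have h1 := LinearMap.finrank_range_of_inj hinj
    rw [φ.finrank_tangentSpace hw₀, hF] at h1
    rw [LinearMap.rank, ← Module.finrank_eq_rank, Nat.cast_le, ← h1]
    exact Submodule.finrank_mono (LinearMap.range_comp_le_range _ _)
  have hrank' : ∀ᶠ y in 𝓝 p, ((s : ℕ) : Cardinal) ≤ (B y).toLinearMap.rank :=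
    hBc.eventually_mem ((isOpen_setOfPred_nat_le_rank s).mem_nhds hrank)
  filter_upwards [hπs, hns, hne, hrank', hσs, hσdom, hσG] with y h1 h2 h3 h4 h5 h6 h7
  have hσd : HasFDerivAt σ (fderiv ℝ σ y) y := (h5.differentiableAt (by simp)).hasFDerivAt
  have hcomp : fderiv ℝ (ν ∘ σ) y = fderiv ℝ ν (σ y) ∘L fderiv ℝ σ y :=
    ((φ.hasFDerivAt_comp hN h6).comp y hσd).fderiv
  refine ⟨h1, h2, ?_, h3, le_antisymm ?_ ?_⟩
  · have d1 := ((hasFDerivAt_id y).sub ((φ.hasFDerivAt_toFun h6).comp y hσd)).inner ℝ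
      ((φ.hasFDerivAt_comp hN h6).comp y hσd)
    refine d1.congr_fderiv ?_
    ext v
    -- The derivative is `⟪v, N⟫ - ⟪dπ v, N⟫ + ⟪y - π y, d(N ∘ π) v⟫`; normality kills the second
    -- term, the foot point equation the third.
    have e1 := hnormal _ (φ.toFun_mem _ h6) _ (φ.fderiv_mem_tangentSpace h6 (fderiv ℝ σ y v))
    have e2 : inner ℝ (y - φ.toFun (σ y)) (fderiv ℝ ν (σ y) (fderiv ℝ σ y v)) = 0 := by
      simpa [G, inner_sub_left] using congrArg (fun L : F →L[ℝ] ℝ => L (fderiv ℝ σ y v)) h7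
    simp only [ν] at e2
    simp [fderivInnerCLM_apply, inner_sub_left, e1] at e2 ⊢
    rw [e2, real_inner_comm]; simp
  · change Module.finrank ℝ (LinearMap.range (B y).toLinearMap) ≤ s
    -- The compression factors through `F`, which has dimension `s`.
    have hB : (B y).toLinearMap = ((perpProj (N (φ.toFun (σ y)))).toLinearMap ∘ₗ
        (fderiv ℝ ν (σ y)).toLinearMap) ∘ₗ
        ((fderiv ℝ σ y).toLinearMap ∘ₗ (perpProj (N (φ.toFun (σ y)))).toLinearMap) := by
      simp only [B, hcomp]
      rfl
    rw [hB]
    refine (Submodule.finrank_mono (LinearMap.range_comp_le_range _ _)).trans ?_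
    exact (LinearMap.finrank_range_le _).trans_eq hF
  · change s ≤ Module.finrank ℝ (LinearMap.range (B y).toLinearMap)
    rwa [LinearMap.rank, ← Module.finrank_eq_rank, Nat.cast_le] at h4

/-! ### Making the normal section nonvanishing -/

/-- Where a normal section vanishes, its derivatives along `S` are normal to the distribution. -/
theorem nabla_mem_orthogonal_of_eq_zero {m : ℕ} {S : Set E} {D : E → Submodule ℝ E}
    (hD : IsSmoothDistribution m S D) {N : E → E} (hN : IsNormalSection S D N) {p : E}
    (hp : p ∈ S) (hNp : N p = 0) {v : E} (hv : v ∈ tangentSpace S p) :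
    nabla S N p v ∈ (D p)ᗮ := by
  obtain ⟨U, X, hU, hpU, hX, hXD⟩ := hD p hp
  induction hv using Submodule.span_induction with
  | mem w hw =>
    obtain ⟨γ, h0, hS, -, hd⟩ := hw
    rw [← (hXD p ⟨hp, hpU⟩).2, Submodule.mem_orthogonal]
    intro x hx
    induction hx using Submodule.span_induction with
    | mem x hx =>
      obtain ⟨i, rfl⟩ := hx
      have hU' : ∀ᶠ t in 𝓝 (0 : ℝ), γ t ∈ U :=
        hd.continuousAt.eventually_mem (by rw [h0]; exact hU.mem_nhds hpU)
      have hSU : ∀ᶠ t in 𝓝 (0 : ℝ), γ t ∈ S ∩ U := hS.and hU'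
      have h1 : HasFDerivWithinAt N (nabla S N p) S p :=
        ((hN.1 p hp).differentiableWithinAt (by simp)).hasFDerivWithinAt
      have h2 := ((hX i p ⟨hp, hpU⟩).differentiableWithinAt (by simp)).hasFDerivWithinAt
      -- Differentiate `⟪X i, N⟫ = 0` along `γ`; the term with the derivative of `X i` vanishes
      -- because `N p = 0`.
      have h3 := (h2.comp_hasDerivAt_of_eq 0 hd hSU h0.symm).inner ℝ
        (h1.comp_hasDerivAt_of_eq 0 hd hS h0.symm)
      have h4 : (fun t => inner ℝ ((X i ∘ γ) t) ((N ∘ γ) t)) =ᶠ[𝓝 0] fun _ => (0 : ℝ) := by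
        filter_upwards [hSU] with t ht
        have h5 : X i (γ t) ∈ D (γ t) := by
          rw [← (hXD _ ht).2]; exact Submodule.subset_span ⟨i, rfl⟩
        exact (hN.2 _ ht.1) _ h5
      have h6 := h3.unique ((hasDerivAt_const (0 : ℝ) (0 : ℝ)).congr_of_eventuallyEq h4)
      simpa [h0, hNp] using h6
    | zero => simp
    | add a b _ _ ha hb => rw [inner_add_left, ha, hb, add_zero]
    | smul c a _ ha => rw [inner_smul_left, ha, mul_zero]
  | zero => simp
  | add a b _ _ ha hb => rw [map_add]; exact Submodule.add_mem _ ha hb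
  | smul c a _ ha => rw [map_smul]; exact Submodule.smul_mem _ _ ha

theorem IsSmoothDistribution.finrank_eq {m : ℕ} {S : Set E} {D : E → Submodule ℝ E}
    (hD : IsSmoothDistribution m S D) {p : E} (hp : p ∈ S) : Module.finrank ℝ (D p) = m := by
  obtain ⟨U, X, -, hpU, -, hXD⟩ := hD p hp
  obtain ⟨h1, h2⟩ := hXD p ⟨hp, hpU⟩
  rw [← h2, finrank_span_eq_card h1, Fintype.card_fin]

variable [FiniteDimensional ℝ E]

/-- A nondegenerate shape operator of positive rank forces the normal section not to vanish. -/
theorem IsNormalSection.ne_zero {m : ℕ} {S : Set E} {D : E → Submodule ℝ E}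
    (hD : IsSmoothDistribution m S D) {N : E → E} (hN : IsNormalSection S D N) {p : E}
    (hp : p ∈ S) (hT : tangentSpace S p ≤ D p)
    (hA : Module.finrank ℝ (LinearMap.range (shapeOperator S N p)) ≠ 0) : N p ≠ 0 := by
  intro hNp
  have h0 : shapeOperator S N p = 0 := by
    ext v
    have h1 := nabla_mem_orthogonal_of_eq_zero hD hN hp hNp v.2
    have h2 := Submodule.orthogonalProjectionOnto_eq_zero_iff.2
      (Submodule.orthogonal_le hT h1)
    simp [shapeOperator, h2]
  rw [h0, LinearMap.range_zero, finrank_bot] at hA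
  exact hA rfl

/-- A `0`-dimensional submanifold is discrete, so that every map on it is smooth. -/
theorem IsEmbeddedSubmanifold.contDiffOn_of_dim_zero {S : Set E}
    (hS : IsEmbeddedSubmanifold 0 S) (f : E → E) : ContDiffOn ℝ ∞ f S := by
  intro p hp
  obtain ⟨W, φ, hW, hpn⟩ := hS.exists_localParam hp
  have := Module.finrank_zero_iff.1 hW
  refine contDiffWithinAt_const.congr_of_eventuallyEq (f := fun _ => f p) ?_ rfl
  filter_upwards [self_mem_nhdsWithin, mem_nhdsWithin_of_mem_nhds (φ.isOpen_nhd.mem_nhds hpn)]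
    with q hq hqn
  rw [← φ.toFun_inv q hq hqn, Subsingleton.elim (φ.inv q) (φ.inv p), φ.toFun_inv p hp hpn]

/-- The normal section may be assumed not to vanish. -/
theorem exists_nonvanishing_normalSection {m s : ℕ} (hE : Module.finrank ℝ E = m + 1) {S : Set E}
    (hS : IsEmbeddedSubmanifold s S) {D : E → Submodule ℝ E} (hD : IsSmoothDistribution m S D)
    (hTS : ∀ p ∈ S, tangentSpace S p ≤ D p)
    (hN : ∃ N : E → E, IsNormalSection S D N ∧
      ∀ p ∈ S, Module.finrank ℝ (LinearMap.range (shapeOperator S N p)) = s) :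
    ∃ N : E → E, IsNormalSection S D N ∧ (∀ p ∈ S, N p ≠ 0) ∧
      ∀ p ∈ S, Module.finrank ℝ (LinearMap.range (shapeOperator S N p)) = s := by
  obtain ⟨N, hN, hA⟩ := hN
  rcases eq_or_ne s 0 with rfl | hs
  -- For `s = 0` the rank condition is vacuous and the given section may vanish; it is replaced by
  -- an arbitrary choice of nonzero normals.
  · have hex : ∀ p ∈ S, ∃ n ∈ (D p)ᗮ, n ≠ 0 := by
      intro p hp
      apply Submodule.exists_mem_ne_zero_of_ne_bot
      intro hbot
      have h1 := (D p).finrank_add_finrank_orthogonal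
      rw [hbot, finrank_bot, hD.finrank_eq hp, hE] at h1
      omega
    choose! n hn hn0 using hex
    refine ⟨n, ⟨hS.contDiffOn_of_dim_zero n, hn⟩, hn0, fun p hp => ?_⟩
    have := LinearMap.finrank_range_le (shapeOperator S n p)
    rw [hS.finrank_tangentSpace hp] at this
    omega
  · exact ⟨N, hN, fun p hp => hN.ne_zero hD hp (hTS p hp) (by rwa [hA p hp]), hA⟩

theorem inner_shapeOperator {S : Set E} {N : E → E} {p : E} (v u : tangentSpace S p) :
    inner ℝ v (shapeOperator S N p u) = inner ℝ (v : E) (nabla S N p u) :=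
  Submodule.inner_orthogonalProjectionOnto_eq_of_mem_left v (nabla S N p u)

/-! ### Construction of the hypersurface -/

/-- A rank-`s` hypersurface solving the Cauchy problem for a nonvanishing normal section. -/
theorem exists_rankSubmanifold {m s : ℕ} (hE : Module.finrank ℝ E = m + 1) {S : Set E}
    (hS : IsEmbeddedSubmanifold s S) {N : E → E} (hN : ContDiffOn ℝ ∞ N S)
    (hnormal : ∀ q ∈ S, ∀ v ∈ tangentSpace S q, inner ℝ v (N q) = 0)
    (hN0 : ∀ p ∈ S, N p ≠ 0)
    (hA : ∀ p ∈ S, Module.finrank ℝ (LinearMap.range (shapeOperator S N p)) = s) :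
    ∃ M : Set E, IsRankSubmanifold m s M ∧ S ⊆ M ∧ ∀ p ∈ S, tangentSpace M p = (ℝ ∙ N p)ᗮ := by
  have : Fact (Module.finrank ℝ E = m + 1) := ⟨hE⟩
  have hloc : ∀ p ∈ S, ∃ π : E → E, π p = p ∧ ContinuousAt π p ∧
      (∀ᶠ y in 𝓝 p, π y ∈ S ∧ IsFootPoint S N y (π y)) ∧
      (∀ᶠ z in 𝓝 (p, p), z.2 ∈ S → IsFootPoint S N z.1 z.2 → z.2 = π z.1) ∧
      ∀ᶠ y in 𝓝 p, IsAdapted s N π y := by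
    intro p hp
    obtain ⟨W, φ, hW, hpn⟩ := hS.exists_localParam hp
    have htop : LinearMap.range (shapeOperator S N p) = ⊤ :=
      Submodule.eq_top_of_finrank_eq (by rw [hA p hp, hS.finrank_tangentSpace hp])
    have hsurj : Function.Surjective (shapeOperator S N p) := LinearMap.range_eq_top.1 htop
    have hinj : Function.Injective (shapeOperator S N p) :=
      LinearMap.injective_iff_surjective.2 hsurj
    -- Surjectivity of the shape operator gives nondegeneracy of `⟪v, ∇_u N⟫` in `v`, injectivity
    -- gives it in `u`; symmetry is not needed.
    refine φ.exists_adapted hW hN hnormal hp hpn (hN0 p hp) ?_ ?_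
    · intro v hv h
      obtain ⟨u, hu⟩ := hsurj ⟨v, hv⟩
      have h1 := inner_shapeOperator (N := N) ⟨v, hv⟩ u
      rw [hu, h u u.2, inner_self_eq_zero] at h1
      exact congrArg Subtype.val h1
    · intro u hu h
      have h1 : shapeOperator S N p ⟨u, hu⟩ = 0 := by
        rw [← inner_self_eq_zero (𝕜 := ℝ), inner_shapeOperator]
        exact h _ (Subtype.property _)
      exact congrArg Subtype.val (hinj (h1.trans (map_zero _).symm))
  choose! g hg1 hg2 hg3 hg4 hg5 using hloc
  obtain ⟨π, hπ⟩ := exists_glue hg1 hg2 hg3 hg4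
  have hπp : ∀ p ∈ S, π p = p := fun p hp => (hπ p hp).self_of_nhds.trans (hg1 p hp)
  -- Being adapted depends only on the germ of the map, so the glued `π` inherits it near each point
  -- of `S`.
  set U : Set E := interior {y | IsAdapted s N π y}
  have hU : ∀ y ∈ U, IsAdapted s N π y := fun y hy => interior_subset hy
  have hSU : S ⊆ U := by
    intro p hp
    rw [mem_interior_iff_mem_nhds]
    filter_upwards [hg5 p hp, (hπ p hp).eventuallyEq_nhds] with y h1 h2 using h1.congr h2
  set h : E → ℝ := fun y => inner ℝ (y - π y) (N (π y))
  have hh : ContDiffOn ℝ ∞ h U := fun y hy =>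
    ((contDiffAt_id.sub (hU y hy).contDiffAt).inner ℝ
      (hU y hy).contDiffAt_normal).contDiffWithinAt
  have hn : ∀ y ∈ U, HasFDerivAt h (innerSL ℝ ((N ∘ π) y)) y := fun y hy => (hU y hy).hasFDerivAt
  have hn0 : ∀ y ∈ U, (N ∘ π) y ≠ 0 := fun y hy => (hU y hy).ne_zero
  have hSh : ∀ p ∈ S, h p = 0 := fun p hp => by simp [h, hπp p hp]
  refine ⟨{y | y ∈ U ∧ h y = 0}, ⟨isEmbeddedSubmanifold_levelSet isOpen_interior hh hn hn0, ?_⟩,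
    fun p hp => ⟨hSU hp, hSh p hp⟩, ?_⟩
  · rintro y ⟨hy, hhy⟩
    have h1 := finrank_relativeNullity_levelSet (m := m) isOpen_interior hh hn hn0 hy hhy
      ((hU y hy).contDiffAt_normal.differentiableAt (by simp))
    have h2 := (hU y hy).finrank_eq
    simp only [Function.comp_apply] at h1
    rwa [h2] at h1
  · intro p hp
    rw [tangentSpace_levelSet (m := m) isOpen_interior hh hn hn0 (hSU hp) (hSh p hp),
      Function.comp_apply, hπp p hp]

end ConstantRank

end

/-- The geometric Cauchy problem for rank-`s` hypersurfaces of `ℝ^(m+1)` has a solution as soon as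
some section of `D^⊥` gives `S` a nonsingular shape operator. -/
theorem corollary1 (m s : ℕ)
    (S : Set (EuclideanSpace ℝ (Fin (m + 1))))
    (hS : ConstantRank.IsEmbeddedSubmanifold s S) (hconn : IsConnected S)
    (D : EuclideanSpace ℝ (Fin (m + 1)) → Submodule ℝ (EuclideanSpace ℝ (Fin (m + 1))))
    (hD : ConstantRank.IsSmoothDistribution m S D)
    (hTS : ∀ p ∈ S, ConstantRank.tangentSpace S p ≤ D p)
    (hN : ∃ N : EuclideanSpace ℝ (Fin (m + 1)) → EuclideanSpace ℝ (Fin (m + 1)),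
      ConstantRank.IsNormalSection S D N ∧
      ∀ p ∈ S, Module.finrank ℝ (LinearMap.range (ConstantRank.shapeOperator S N p)) = s) :
    ∃ M : Set (EuclideanSpace ℝ (Fin (m + 1))),
      ConstantRank.IsRankSubmanifold m s M ∧ S ⊆ M ∧
      ∀ p ∈ S, ConstantRank.tangentSpace M p = D p := by
  have hE : Module.finrank ℝ (EuclideanSpace ℝ (Fin (m + 1))) = m + 1 := by simp
  obtain ⟨N, hNS, hN0, hA⟩ :=
    ConstantRank.exists_nonvanishing_normalSection hE hS hD hTS hN
  obtain ⟨M, hM, hSM, hT⟩ := ConstantRank.exists_rankSubmanifold hE hS hNS.1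
    (fun q hq v hv => hNS.2 q hq v (hTS q hq hv)) hN0 hA
  refine ⟨M, hM, hSM, fun p hp => ?_⟩
  have : Fact (Module.finrank ℝ (EuclideanSpace ℝ (Fin (m + 1))) = m + 1) := ⟨hE⟩
  rw [hT p hp]
  symm
  apply Submodule.eq_of_le_of_finrank_eq
  · intro x hx
    rw [Submodule.mem_orthogonal_singleton_iff_inner_left]
    exact hNS.2 p hp x hx
  · rw [hD.finrank_eq hp, Submodule.finrank_orthogonal_span_singleton (n := m) (hN0 p hp)]
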